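/- **Setting.** There are sets of enterprises, shards and nodes. The cluster of enterprise $e$ that maintains shard $s$ is written $(e,s)$; a node belongs to only one cluster. A cluster is either crash-only ($2f+1$ nodes, which both order and execute; local-majority $f+1$) or Byzantine ($3f+1$ ordering nodes, at most $f$ of them faulty; local-majority $2f+1$; and $2g+1$ separate execution nodes, at most $g$ of them faulty). A data collection $d_X$ is shared by the set $X$ of enterprises, which use the same sharding schema for it; $d_X$ is order-dependent on $d_Y$ if $X\subsetneq Y$. A request $m$ on $d_X$ accesses a set $T$ of shards of $d_X$; its set of involved clusters is $\mathcal P(m)=X\times T$, one of which is its coordinator cluster (whose enterprise is the initiator enterprise). Two requests intersect in a shard $s$ if some cluster $(e,s)$ is involved in both. On each shard $s\in T$, $m$ receives an identifier $\mathrm{ID}_s(m)=\langle n_s(m),\gamma_s(m)\rangle$: a sequence number, and for every $d_Y$ on which $d_X$ is order-dependent the number $\gamma_s(m)(Y)$ of the last request committed on shard $s$ of $d_Y$ ($0$ if there is none). **Protocol.** The network is asynchronous, messages are signed and signatures cannot be forged; a message of a cluster is one signed by a local-majority of its ordering nodes. Faulty nodes may send any messages under their own signatures; a non-faulty node may stop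 at any time and otherwise takes only the following steps. 1. *Prepare.* Nodes of the coordinator cluster sign $\langle \mathrm{PREPARE}, \mathrm{ID}_c, m\rangle$. 2. *Prepared.* Nodes of every other involved cluster sign $\langle \mathrm{PREPARED}, \mathrm{ID}_c, \mathrm{ID}_s, m\rangle$, where $s$ is their shard: in the initiator enterprise, upon the prepare message of the coordinator cluster, with an $\mathrm{ID}_s$ chosen in their cluster; in other enterprises, with the $\mathrm{ID}_s$ in the message of the cluster of the initiator enterprise that maintains the same shard. 3. *Commit.* When the coordinator cluster has matching prepared messages from a local-majority of every involved cluster (and its own prepare message), its nodes sign a commit message carrying all the $\mathrm{ID}_s$. A node of the coordinator cluster may instead sign an abort message, but it never signs both. A node of an involved cluster that receives the commit message of the coordinator cluster commits $m$, once, with these identifiers; a node that receives its abort message records the abort. 4. *Execution.* An execution node executes a committed request, once, after it has executed requests with all lower sequence numbers on the same shard of the same data collection. In steps 1 and 2 a node processes a request $m$ (signs an identifier for it) at most once, and only if (i) the sequence number exceeds all those it has committed on this shard of the data collection and differs from those of the other requests it has processed there, and $\gamma_s(m)$ records the last sequence numbers it has committed; (ii) there is no concurrent request, i.e. one that it has processed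 but neither committed nor seen aborted, that intersects $m$ in at least two shards. **Order.** Let $m$ on $d_X$ and $m'$ on $d_{X'}$ be committed on a node $r$ of a cluster with shard $s$. Then $m$ is *committed after* $m'$ on $r$ if, in the ledger of $r$: $X=X'$ and $n_s(m')<n_s(m)$; or $X\subsetneq X'$ and $n_s(m')\le\gamma_s(m)(X')$; or $X'\subsetneq X$ and $\gamma_s(m')(X)<n_s(m)$. (Requests on collections neither of which is order-dependent on the other are not ordered.) **Proposition (Consistency).** Consider any execution of the protocol, requests $m,m'$, clusters $P_i,P_j\in\mathcal P(m)\cap\mathcal P(m')$ and non-faulty nodes $r_1\in P_i$, $r_2\in P_j$. (a) If at some time $m$ is committed after $m'$ on $r_1$, then at any time at which both are committed on $r_2$, $m$ is committed after $m'$ on $r_2$. (b) If $m$ and $m'$ are requests on the same data collection and at some time $r_1$ has executed $m$ after $m'$, then at any time at which $r_2$ has executed $m$, it has executed $m'$ before $m$. -/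

import Mathlib

namespace Qanaat

/-- A client request. `payload` carries the operation, the timestamp and the client; `coll` is the
set `X` of enterprises sharing the data collection `d_X` on which the request is executed (a data
collection is identified with that set); `shards` are the shards of `d_X` that it accesses; `coord`
is the coordinator cluster, i.e. the cluster that received the request. The cluster of enterprise
`e` that maintains shard `s` is the pair `(e, s)`. -/
structure Request (E S A : Type*) where
  payload : A
  coll : Finset E
  shards : Finset S
  coord : E × S

/-- The set of clusters involved in a request: all clusters of the enterprises sharing its data
collection that maintain one of the shards it accesses. -/
def Request.involved {E S A : Type*} (m : Request E S A) : Finset (E × S) :=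
  m.coll ×ˢ m.shards

/-- The shards in which two requests intersect: the shards of the clusters involved in both. -/
def sharedShards {E S A : Type*} [DecidableEq E] [DecidableEq S] (m m' : Request E S A) :
    Finset S :=
  (m.involved ∩ m'.involved).image Prod.snd

/-- The identifier `⟨α, γ⟩` of a request on one shard of its data collection `d_X`: `num` is the
sequence number in the local part `α = [X : num]`, and `state Y` is the number recorded in the
global part `γ` for a data collection `d_Y` on which `d_X` is order-dependent (`0`: nothing has
been committed on `d_Y`). -/
structure TxId (E : Type*) where
  num : ℕ
  state : Finset E → ℕ

/-- The order that identifiers impose in the ledger of one shard: request `m`, with identifier `id`,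
comes after request `m'`, with identifier `id'`. On the same data collection the sequence numbers
decide. If the collection of `m` is order-dependent on that of `m'`, then `m` comes after `m'` iff
`m'` belongs to the state that `m` has captured; in the converse case iff `m` does not belong to the
state that `m'` has captured. Requests on collections neither of which is order-dependent on the
other are not ordered. -/
def OrderedAfter {E S A : Type*} (m : Request E S A) (id : TxId E)
    (m' : Request E S A) (id' : TxId E) : Prop :=
  (m.coll = m'.coll ∧ id'.num < id.num) ∨
  (m.coll ⊂ m'.coll ∧ id'.num ≤ id.state m'.coll) ∨
  (m'.coll ⊂ m.coll ∧ id'.state m.coll < id.num)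

inductive FailureModel
  | crash
  | byzantine

/-- A deployment: enterprises `E`, shards `S`, nodes `V`. `faulty` is the set of Byzantine nodes.
Nodes that crash are not singled out: a crashed node is one that takes no further step, and no node
is ever forced to take a step. -/
structure Config (E S V : Type*) where
  /-- the existing clusters -/
  clusters : Set (E × S)
  /-- the sharding schema of each data collection, common to all enterprises sharing it -/
  schema : Finset E → Finset S
  model : E × S → FailureModel
  f : E × S → ℕ
  g : E × S → ℕ
  ordering : E × S → Finset V
  execution : E × S → Finset V
  faulty : Set V
  schema_clusters : ∀ X, ∀ s ∈ schema X, ∀ e ∈ X, (e, s) ∈ clusters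
  /-- a node belongs to one cluster only -/
  cluster_unique : ∀ P ∈ clusters, ∀ Q ∈ clusters, ∀ v,
    v ∈ ordering P ∨ v ∈ execution P → v ∈ ordering Q ∨ v ∈ execution Q → P = Q
  /-- crash-only clusters: `2f+1` nodes that both order and execute, none of them Byzantine -/
  crash_cluster : ∀ P ∈ clusters, model P = .crash →
    (ordering P).card = 2 * f P + 1 ∧ execution P = ordering P ∧ ∀ v ∈ ordering P, v ∉ faulty
  /-- Byzantine clusters: `3f+1` ordering nodes, at most `f` of them faulty, and `2g+1` separate
  execution nodes, at most `g` of them faulty -/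
  byzantine_cluster : ∀ P ∈ clusters, model P = .byzantine →
    (ordering P).card = 3 * f P + 1 ∧ ((ordering P : Set V) ∩ faulty).ncard ≤ f P ∧
    (execution P).card = 2 * g P + 1 ∧ ((execution P : Set V) ∩ faulty).ncard ≤ g P ∧
    Disjoint (ordering P) (execution P)

/-- `v` is a node of cluster `P`. -/
def Config.IsNode {E S V : Type*} (cfg : Config E S V) (P : E × S) (v : V) : Prop :=
  v ∈ cfg.ordering P ∨ v ∈ cfg.execution P

/-- The number of matching votes of ordering nodes that a cluster needs. -/
def Config.localMajority {E S V : Type*} (cfg : Config E S V) (P : E × S) : ℕ :=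
  match cfg.model P with
  | .crash => cfg.f P + 1
  | .byzantine => 2 * cfg.f P + 1

/-- A valid request accesses existing shards of its data collection, and its coordinator cluster is
one of the involved clusters. -/
def Config.ValidRequest {E S V A : Type*} (cfg : Config E S V) (m : Request E S A) : Prop :=
  m.shards ⊆ cfg.schema m.coll ∧ m.coord ∈ m.involved

/-- Messages signed by a single node. A message signed by a cluster is represented by matching
messages signed by a local-majority of its ordering nodes. -/
inductive Msg (E S V A : Type*)
  /-- a node `v` of the coordinator cluster agrees to the identifier `idc` of `m` on its shard -/
  | prepare (v : V) (m : Request E S A) (idc : TxId E)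
  /-- a node `v` of another involved cluster agrees to the identifier `id` of `m` on its shard,
  where the coordinator cluster has chosen `idc` -/
  | prepared (v : V) (m : Request E S A) (idc id : TxId E)
  /-- a node `v` of the coordinator cluster agrees to commit `m` with identifier `ids s` on each
  accessed shard `s` -/
  | commit (v : V) (m : Request E S A) (ids : S → TxId E)
  /-- a node `v` of the coordinator cluster agrees to abort `m` -/
  | abort (v : V) (m : Request E S A)

def Msg.signer {E S V A : Type*} : Msg E S V A → V
  | .prepare v _ _ => v
  | .prepared v _ _ _ => v
  | .commit v _ _ => v
  | .abort v _ => v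

/-- A global state: the messages sent so far (the network is asynchronous: a sent message may be
received at any later time, any number of times, or never), and for each node the blocks that it
has committed, the requests that it has executed, in the order of execution, and the requests that
it knows to be aborted. -/
structure State (E S V A : Type*) where
  net : Set (Msg E S V A)
  committed : V → List (Request E S A × (S → TxId E))
  executed : V → List (Request E S A)
  aborted : V → Set (Request E S A)

def State.init (E S V A : Type*) : State E S V A where
  net := ∅
  committed := fun _ => []
  executed := fun _ => []
  aborted := fun _ => ∅

section State

variable {E S V A : Type*}

/-- A local-majority of the ordering nodes of `P` has signed the message `msg v`. -/
def State.Signed (σ : State E S V A) (cfg : Config E S V) (P : E × S) (msg : V → Msg E S V A) :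
    Prop :=
  ∃ Q ⊆ cfg.ordering P, cfg.localMajority P ≤ Q.card ∧ ∀ v ∈ Q, msg v ∈ σ.net

/-- The coordinator cluster has signed a `prepare` message. -/
def State.PrepareCert (σ : State E S V A) (cfg : Config E S V) (m : Request E S A)
    (idc : TxId E) : Prop :=
  σ.Signed cfg m.coord fun v => .prepare v m idc

/-- A local-majority of cluster `P` has signed a `prepared` message. -/
def State.PreparedCert (σ : State E S V A) (cfg : Config E S V) (P : E × S) (m : Request E S A)
    (idc id : TxId E) : Prop :=
  σ.Signed cfg P fun v => .prepared v m idc id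

/-- The coordinator cluster has signed a `commit` message. -/
def State.CommitCert (σ : State E S V A) (cfg : Config E S V) (m : Request E S A)
    (ids : S → TxId E) : Prop :=
  σ.Signed cfg m.coord fun v => .commit v m ids

/-- The coordinator cluster has signed an `abort` message. -/
def State.AbortCert (σ : State E S V A) (cfg : Config E S V) (m : Request E S A) : Prop :=
  σ.Signed cfg m.coord fun v => .abort v m

/-- Matching `prepared` messages from every involved cluster (for the coordinator cluster itself,
its `prepare` message). -/
def State.AllPrepared (σ : State E S V A) (cfg : Config E S V) (m : Request E S A)
    (ids : S → TxId E) : Prop :=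
  σ.PrepareCert cfg m (ids m.coord.2) ∧
  ∀ P ∈ m.involved, P ≠ m.coord → σ.PreparedCert cfg P m (ids m.coord.2) (ids P.2)

/-- Node `v` has agreed to process `m` with identifier `id` on its own shard. -/
def State.Processed (σ : State E S V A) (v : V) (m : Request E S A) (id : TxId E) : Prop :=
  .prepare v m id ∈ σ.net ∨ ∃ idc, .prepared v m idc id ∈ σ.net

/-- Request `m` is committed on node `v`. -/
def State.CommittedOn (σ : State E S V A) (v : V) (m : Request E S A) : Prop :=
  ∃ ids, (m, ids) ∈ σ.committed v

/-- On node `v`, which maintains shard `s`, both requests are committed, and `m` comes after `m'`. -/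
def State.CommittedAfter (σ : State E S V A) (v : V) (s : S) (m m' : Request E S A) : Prop :=
  ∃ ids ids', (m, ids) ∈ σ.committed v ∧ (m', ids') ∈ σ.committed v ∧
    OrderedAfter m (ids s) m' (ids' s)

/-- Node `v` has executed both requests, and `m` after `m'`. -/
def State.ExecutedAfter (σ : State E S V A) (v : V) (m m' : Request E S A) : Prop :=
  [m', m].Sublist (σ.executed v)

variable [DecidableEq E] [DecidableEq S]

/-- The largest sequence number committed on node `v` for shard `s` of data collection `d_X`
(`0` if there is none). -/
def State.lastCommitted (σ : State E S V A) (v : V) (X : Finset E) (s : S) : ℕ :=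
  ((σ.committed v).map fun b =>
    if b.1.coll = X ∧ s ∈ b.1.shards then (b.2 s).num else 0).foldr max 0

/-- Node `v`, which maintains shard `s`, considers `id` a valid identifier of `m` on that shard: the
sequence number is larger than those already committed on the data collection and not in use for
another request, and the global part records the last committed sequence number of each data
collection on which the collection of `m` is order-dependent. -/
def State.ValidId (σ : State E S V A) (v : V) (s : S) (m : Request E S A) (id : TxId E) : Prop :=
  σ.lastCommitted v m.coll s < id.num ∧
  (∀ m' id', σ.Processed v m' id' → m'.coll = m.coll → m' ≠ m → id'.num ≠ id.num) ∧
  ∀ Y, id.state Y = if m.coll ⊂ Y then σ.lastCommitted v Y s else 0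

/-- Node `v` may process `m`: it has not processed it before, and there is no concurrent request,
i.e. one that `v` has processed and that is neither committed nor aborted on `v`, that intersects
`m` in at least two shards. -/
def State.Admissible (σ : State E S V A) (v : V) (m : Request E S A) : Prop :=
  (∀ id, ¬ σ.Processed v m id) ∧
  ∀ m' id', σ.Processed v m' id' → 2 ≤ (sharedShards m m').card →
    σ.CommittedOn v m' ∨ m' ∈ σ.aborted v

def State.send (σ : State E S V A) (x : Msg E S V A) : State E S V A :=
  { σ with net := insert x σ.net }

open Classical in
/-- Node `v` appends a block. -/
noncomputable def State.append (σ : State E S V A) (v : V)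
    (b : Request E S A × (S → TxId E)) : State E S V A :=
  { σ with committed := Function.update σ.committed v (σ.committed v ++ [b]) }

open Classical in
/-- Node `v` executes `m`. -/
noncomputable def State.execute (σ : State E S V A) (v : V) (m : Request E S A) : State E S V A :=
  { σ with executed := Function.update σ.executed v (σ.executed v ++ [m]) }

open Classical in
/-- Node `v` learns that `m` is aborted. -/
noncomputable def State.recordAbort (σ : State E S V A) (v : V) (m : Request E S A) :
    State E S V A :=
  { σ with aborted := Function.update σ.aborted v (insert m (σ.aborted v)) }

/-- The steps of the coordinator-based protocols. A step reads only the local state of one node and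
messages that have been sent. The proposals of primaries, which may be faulty or be replaced at any
time, are arbitrary: a non-faulty node, the primary or another one, may sign any identifier that
passes its checks. -/
inductive Step (cfg : Config E S V) : State E S V A → State E S V A → Prop
  /-- prepare: consensus in the coordinator cluster on the identifier of `m` on its shard -/
  | prepare (σ : State E S V A) (v : V) (m : Request E S A) (idc : TxId E) :
      v ∉ cfg.faulty → cfg.ValidRequest m → v ∈ cfg.ordering m.coord →
      σ.Admissible v m → σ.ValidId v m.coord.2 m idc →
      Step cfg σ (σ.send (.prepare v m idc))
  /-- prepared: consensus in another involved cluster of the initiator enterprise on the identifier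
  of `m` on its shard, after a `prepare` message of the coordinator cluster -/
  | preparedInitiator (σ : State E S V A) (v : V) (m : Request E S A) (s : S) (idc id : TxId E) :
      v ∉ cfg.faulty → cfg.ValidRequest m → s ∈ m.shards → s ≠ m.coord.2 →
      v ∈ cfg.ordering (m.coord.1, s) → σ.PrepareCert cfg m idc →
      σ.Admissible v m → σ.ValidId v s m id →
      Step cfg σ (σ.send (.prepared v m idc id))
  /-- prepared: a node of another enterprise, maintaining the same shard as the coordinator
  cluster, validates the identifier in the `prepare` message -/
  | preparedSameShard (σ : State E S V A) (v : V) (m : Request E S A) (e : E) (idc : TxId E) :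
      v ∉ cfg.faulty → cfg.ValidRequest m → e ∈ m.coll → e ≠ m.coord.1 →
      v ∈ cfg.ordering (e, m.coord.2) → σ.PrepareCert cfg m idc →
      σ.Admissible v m → σ.ValidId v m.coord.2 m idc →
      Step cfg σ (σ.send (.prepared v m idc idc))
  /-- prepared: a node of another enterprise, maintaining another shard, validates the identifier
  in the `prepared` message of the cluster of the initiator enterprise that maintains its shard -/
  | preparedOtherShard (σ : State E S V A) (v : V) (m : Request E S A) (e : E) (s : S)
      (idc id : TxId E) :
      v ∉ cfg.faulty → cfg.ValidRequest m → e ∈ m.coll → e ≠ m.coord.1 →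
      s ∈ m.shards → s ≠ m.coord.2 →
      v ∈ cfg.ordering (e, s) → σ.PreparedCert cfg (m.coord.1, s) m idc id →
      σ.Admissible v m → σ.ValidId v s m id →
      Step cfg σ (σ.send (.prepared v m idc id))
  /-- commit: consensus in the coordinator cluster to commit, after `prepared` messages from every
  involved cluster -/
  | commitVote (σ : State E S V A) (v : V) (m : Request E S A) (ids : S → TxId E) :
      v ∉ cfg.faulty → cfg.ValidRequest m → v ∈ cfg.ordering m.coord →
      σ.AllPrepared cfg m ids → .abort v m ∉ σ.net →
      Step cfg σ (σ.send (.commit v m ids))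
  /-- abort: consensus in the coordinator cluster to abort, for whatever reason -/
  | abortVote (σ : State E S V A) (v : V) (m : Request E S A) :
      v ∉ cfg.faulty → cfg.ValidRequest m → v ∈ cfg.ordering m.coord →
      (∀ ids, .commit v m ids ∉ σ.net) →
      Step cfg σ (σ.send (.abort v m))
  /-- a node of an involved cluster receives a `commit` message and commits the request -/
  | commit (σ : State E S V A) (v : V) (m : Request E S A) (P : E × S) (ids : S → TxId E) :
      v ∉ cfg.faulty → cfg.ValidRequest m → P ∈ m.involved → cfg.IsNode P v →
      σ.CommitCert cfg m ids → ¬ σ.CommittedOn v m →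
      Step cfg σ (σ.append v (m, ids))
  /-- an execution node executes a committed request once it has executed requests with all lower
  sequence numbers on the same shard of the same data collection -/
  | execute (σ : State E S V A) (v : V) (m : Request E S A) (P : E × S) (ids : S → TxId E) :
      v ∉ cfg.faulty → P ∈ m.involved → v ∈ cfg.execution P →
      (m, ids) ∈ σ.committed v → m ∉ σ.executed v →
      (∀ k, 0 < k → k < (ids P.2).num → ∃ m' ids', (m', ids') ∈ σ.committed v ∧
        m' ∈ σ.executed v ∧ m'.coll = m.coll ∧ (ids' P.2).num = k) →
      Step cfg σ (σ.execute v m)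
  /-- a node of an involved cluster receives an `abort` message -/
  | abort (σ : State E S V A) (v : V) (m : Request E S A) (P : E × S) :
      v ∉ cfg.faulty → cfg.ValidRequest m → P ∈ m.involved → cfg.IsNode P v →
      σ.AbortCert cfg m →
      Step cfg σ (σ.recordAbort v m)
  /-- a faulty node sends any message with its own signature -/
  | byzantine (σ : State E S V A) (x : Msg E S V A) :
      x.signer ∈ cfg.faulty →
      Step cfg σ (σ.send x)

/-- An execution: a sequence of global states that starts in the initial one and in which, at each
time, one step or nothing happens. -/
def IsExecution (cfg : Config E S V) (σ : ℕ → State E S V A) : Prop :=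
  σ 0 = State.init E S V A ∧ ∀ t, σ (t + 1) = σ t ∨ Step cfg (σ t) (σ (t + 1))

end State

end Qanaat

/-! Two local-majorities of one cluster share a non-faulty node, and such a node processes a request
at most once. Hence the identifier of a prepared request on each of its shards is unique
(`ids_unique`), and distinct requests of one collection never share a sequence number in a common
cluster (`eq_of_num_eq`).

For (a), common clusters on the same shard read the same identifiers, so only requests meeting in
two shards matter. Compare the first times at which each is prepared by all its involved clusters;
say `m'` comes no later than `m`. In every common cluster some non-faulty node processed both. Had
it processed `m` first, the concurrency check would require `m` to be committed or aborted there
before it processed `m'`. Commitment contradicts the choice of `m'` as the earlier one, and abortion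
contradicts the commit certificate of `m`. So `m'` was processed first and was already committed
when `m` was processed, which puts `m` after `m'` (`orderedAfter_of_prepared_le`). The comparison of
times involves no cluster, so all common clusters agree (`orderedAfter_transfer`).

For (b), execution has no gaps in sequence numbers, and a number determines its request. So the
order of execution is that of the numbers, to which (a) applies. -/

namespace Qanaat

variable {E S V A : Type*}

/-! ### Clusters and quorum intersection. -/

theorem Config.involved_mem_clusters {cfg : Config E S V} {m : Request E S A}
    (hm : cfg.ValidRequest m) {P : E × S} (hP : P ∈ m.involved) : P ∈ cfg.clusters := by
  obtain ⟨e, s⟩ := P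
  rw [Request.involved, Finset.mem_product] at hP
  exact cfg.schema_clusters m.coll s (hm.1 hP.2) e hP.1

theorem Config.eq_of_isNode {cfg : Config E S V} {m m' : Request E S A}
    (hm : cfg.ValidRequest m) (hm' : cfg.ValidRequest m') {P P' : E × S}
    (hP : P ∈ m.involved) (hP' : P' ∈ m'.involved) {v : V}
    (hv : cfg.IsNode P v) (hv' : cfg.IsNode P' v) : P = P' :=
  cfg.cluster_unique P (involved_mem_clusters hm hP) P' (involved_mem_clusters hm' hP') v hv hv'

/-- Two local-majorities of a cluster have a non-faulty node in common. -/
theorem Config.exists_nonfaulty_of_quorums (cfg : Config E S V) {P : E × S}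
    (hP : P ∈ cfg.clusters) {Q Q' : Finset V} (hQ : Q ⊆ cfg.ordering P)
    (hQ' : Q' ⊆ cfg.ordering P) (hc : cfg.localMajority P ≤ Q.card)
    (hc' : cfg.localMajority P ≤ Q'.card) :
    ∃ v ∈ Q, v ∈ Q' ∧ v ∉ cfg.faulty := by
  classical
  have hu : (Q ∪ Q').card ≤ (cfg.ordering P).card :=
    Finset.card_le_card (Finset.union_subset hQ hQ')
  have hi := Finset.card_union_add_card_inter Q Q'
  cases hmod : cfg.model P with
  | crash =>
    obtain ⟨hcard, -, hnf⟩ := cfg.crash_cluster P hP hmod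
    simp only [Config.localMajority, hmod] at hc hc'
    -- Two sets of at least `f + 1` nodes among `2f + 1` must meet.
    have hpos : 0 < (Q ∩ Q').card := by omega
    obtain ⟨v, hv⟩ := Finset.card_pos.mp hpos
    rw [Finset.mem_inter] at hv
    exact ⟨v, hv.1, hv.2, hnf v (hQ hv.1)⟩
  | byzantine =>
    obtain ⟨hcard, hf, -⟩ := cfg.byzantine_cluster P hP hmod
    simp only [Config.localMajority, hmod] at hc hc'
    by_contra hno
    push Not at hno
    have hsub : ((Q ∩ Q' : Finset V) : Set V) ⊆ (cfg.ordering P : Set V) ∩ cfg.faulty := by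
      intro v hv
      rw [Finset.mem_coe, Finset.mem_inter] at hv
      exact ⟨hQ hv.1, hno v hv.1 hv.2⟩
    have hle := Set.ncard_le_ncard hsub ((cfg.ordering P).finite_toSet.inter_of_left _)
    rw [Set.ncard_coe_finset] at hle
    -- The intersection has at least `2(2f + 1) - (3f + 1) = f + 1` nodes, too many to be all
    -- faulty.
    omega

theorem Signed.exists_nonfaulty {cfg : Config E S V} {σ σ' : State E S V A} {P : E × S}
    (hP : P ∈ cfg.clusters) {msg msg' : V → Msg E S V A}
    (h : σ.Signed cfg P msg) (h' : σ'.Signed cfg P msg') :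
    ∃ v ∈ cfg.ordering P, v ∉ cfg.faulty ∧ msg v ∈ σ.net ∧ msg' v ∈ σ'.net := by
  obtain ⟨Q, hQ, hc, hs⟩ := h
  obtain ⟨Q', hQ', hc', hs'⟩ := h'
  obtain ⟨v, hv, hv', hvf⟩ := cfg.exists_nonfaulty_of_quorums hP hQ hQ' hc hc'
  exact ⟨v, hQ hv, hvf, hs v hv, hs' v hv'⟩

/-- The vote of a non-faulty node contained in the evidence that every involved cluster is
prepared. -/
theorem AllPrepared.exists_processed {cfg : Config E S V} {σ σ' : State E S V A}
    {m m' : Request E S A} {ids ids' : S → TxId E} {P : E × S}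
    (hm : cfg.ValidRequest m) (hP : P ∈ m.involved) (hP' : P ∈ m'.involved)
    (h : σ.AllPrepared cfg m ids) (h' : σ'.AllPrepared cfg m' ids') :
    ∃ v ∈ cfg.ordering P, v ∉ cfg.faulty ∧ σ.Processed v m (ids P.2) ∧
      σ'.Processed v m' (ids' P.2) := by
  have key : ∀ (τ : State E S V A) (n : Request E S A) (i : S → TxId E), P ∈ n.involved →
      τ.AllPrepared cfg n i →
      ∃ msg, τ.Signed cfg P msg ∧ ∀ v, msg v ∈ τ.net → τ.Processed v n (i P.2) := by
    intro τ n i hn hi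
    -- The coordinator cluster votes by `prepare`, the others by `prepared`; `Processed` covers
    -- both.
    by_cases hc : P = n.coord
    · subst hc
      exact ⟨_, hi.1, fun v hv => Or.inl hv⟩
    · exact ⟨_, hi.2 P hn hc, fun v hv => Or.inr ⟨_, hv⟩⟩
  obtain ⟨msg, hs, hp⟩ := key σ m ids hP h
  obtain ⟨msg', hs', hp'⟩ := key σ' m' ids' hP' h'
  obtain ⟨v, hv, hvf, h1, h2⟩ :=
    Signed.exists_nonfaulty (Config.involved_mem_clusters hm hP) hs hs'
  exact ⟨v, hv, hvf, hp v h1, hp' v h2⟩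

/-! ### The order of identifiers, maxima and lists. -/

/-- When the requests are exchanged, the second and third alternatives become contradictory
inequalities under the same inclusion; all other mixed cases contradict strictness of inclusion. -/
theorem OrderedAfter.asymm {m m' : Request E S A} {id id' : TxId E}
    (h : OrderedAfter m id m' id') : ¬ OrderedAfter m' id' m id := by
  rintro (⟨h1, h2⟩ | ⟨h1, h2⟩ | ⟨h1, h2⟩) <;> rcases h with ⟨h3, h4⟩ | ⟨h3, h4⟩ | ⟨h3, h4⟩
  all_goals first
    | omega
    | exact ssubset_irrefl _ (h1.trans h3)
    | (rw [h1] at h3; exact ssubset_irrefl _ h3)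
    | (rw [h3] at h1; exact ssubset_irrefl _ h1)

theorem OrderedAfter.comparable {m m' : Request E S A} {id id' : TxId E}
    (h : OrderedAfter m id m' id') :
    m.coll = m'.coll ∨ m.coll ⊂ m'.coll ∨ m'.coll ⊂ m.coll := by
  rcases h with h | h | h
  exacts [Or.inl h.1, Or.inr (Or.inl h.1), Or.inr (Or.inr h.1)]

theorem le_foldr_max {l : List ℕ} {a : ℕ} (h : a ∈ l) : a ≤ l.foldr max 0 := by
  induction l with
  | nil => simp at h
  | cons b l ih =>
    rcases List.mem_cons.mp h with rfl | h
    · exact le_max_left _ _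
    · exact (ih h).trans (le_max_right _ _)

theorem foldr_max_le {l : List ℕ} {c : ℕ} (h : ∀ a ∈ l, a ≤ c) : l.foldr max 0 ≤ c := by
  induction l with
  | nil => exact Nat.zero_le _
  | cons b l ih =>
    exact max_le (h b List.mem_cons_self) (ih fun a ha => h a (List.mem_cons_of_mem _ ha))

theorem not_sublist_swap {α : Type*} {l : List α} {a b : α} (hl : l.Nodup)
    (h : [a, b].Sublist l) : ¬ [b, a].Sublist l := by
  intro h'
  induction l with
  | nil => simp at h
  | cons c l ih =>
    rw [List.nodup_cons] at hl
    rw [List.cons_sublist_cons'] at h h'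
    rcases h with h | ⟨rfl, h⟩ <;> rcases h' with h' | ⟨rfl, h'⟩
    · exact ih hl.2 h h'
    · exact hl.1 (h.subset (by simp))
    · exact hl.1 (h'.subset (by simp))
    · exact hl.1 (List.singleton_sublist.mp h)

variable [DecidableEq E] [DecidableEq S]

theorem State.le_lastCommitted {σ : State E S V A} {v : V} {m : Request E S A}
    {ids : S → TxId E} {s : S} (h : (m, ids) ∈ σ.committed v) (hs : s ∈ m.shards) :
    (ids s).num ≤ σ.lastCommitted v m.coll s :=
  le_foldr_max (List.mem_map.mpr ⟨(m, ids), h, by simp [hs]⟩)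

theorem State.lastCommitted_mono {σ σ' : State E S V A} {v : V}
    (h : σ.committed v ⊆ σ'.committed v) (X : Finset E) (s : S) :
    σ.lastCommitted v X s ≤ σ'.lastCommitted v X s := by
  refine foldr_max_le fun a ha => le_foldr_max ?_
  obtain ⟨b, hb, rfl⟩ := List.mem_map.mp ha
  exact List.mem_map.mpr ⟨b, h hb, rfl⟩

/-! ### The effect of a single step. -/

/-- The condition under which a non-faulty node sends a message. -/
def Justified (cfg : Config E S V) (σ : State E S V A) : Msg E S V A → Prop
  | .prepare v m id => cfg.ValidRequest m ∧
      ∃ P ∈ m.involved, v ∈ cfg.ordering P ∧ σ.Admissible v m ∧ σ.ValidId v P.2 m id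
  | .prepared v m _ id => cfg.ValidRequest m ∧
      ∃ P ∈ m.involved, v ∈ cfg.ordering P ∧ σ.Admissible v m ∧ σ.ValidId v P.2 m id
  | .commit v m ids => σ.AllPrepared cfg m ids ∧ .abort v m ∉ σ.net
  | .abort v m => ∀ ids, .commit v m ids ∉ σ.net

theorem Step.net_cases {cfg : Config E S V} {σ σ' : State E S V A} (h : Step cfg σ σ') :
    σ'.net = σ.net ∨
      ∃ x, σ'.net = insert x σ.net ∧ (x.signer ∉ cfg.faulty → Justified cfg σ x) := by
  cases h with
  | prepare v m idc hf hm hv ha hi =>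
    exact Or.inr ⟨_, rfl, fun _ => ⟨hm, m.coord, hm.2, hv, ha, hi⟩⟩
  | preparedInitiator v m s idc id hf hm hs hne hv hc ha hi =>
    exact Or.inr ⟨_, rfl, fun _ => ⟨hm, (m.coord.1, s),
      Finset.mem_product.mpr ⟨(Finset.mem_product.mp hm.2).1, hs⟩, hv, ha, hi⟩⟩
  | preparedSameShard v m e idc hf hm he hne hv hc ha hi =>
    exact Or.inr ⟨_, rfl, fun _ => ⟨hm, (e, m.coord.2),
      Finset.mem_product.mpr ⟨he, (Finset.mem_product.mp hm.2).2⟩, hv, ha, hi⟩⟩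
  | preparedOtherShard v m e s idc id hf hm he hne hs hne' hv hc ha hi =>
    exact Or.inr ⟨_, rfl, fun _ => ⟨hm, (e, s),
      Finset.mem_product.mpr ⟨he, hs⟩, hv, ha, hi⟩⟩
  | commitVote v m ids hf hm hv hp ha => exact Or.inr ⟨_, rfl, fun _ => ⟨hp, ha⟩⟩
  | abortVote v m hf hm hv hc => exact Or.inr ⟨_, rfl, fun _ => hc⟩
  | commit => exact Or.inl rfl
  | execute => exact Or.inl rfl
  | abort => exact Or.inl rfl
  | byzantine x hx => exact Or.inr ⟨x, rfl, fun hn => absurd hx hn⟩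

theorem Step.committed_cases {cfg : Config E S V} {σ σ' : State E S V A} (h : Step cfg σ σ')
    (v : V) : σ'.committed v = σ.committed v ∨
      ∃ m ids, σ'.committed v = σ.committed v ++ [(m, ids)] ∧ cfg.ValidRequest m ∧
        (∃ P ∈ m.involved, cfg.IsNode P v) ∧ σ.CommitCert cfg m ids := by
  cases h with
  | commit w m P ids hf hm hP hn hc hnc =>
    by_cases hw : v = w
    · subst hw
      exact Or.inr ⟨m, ids, by simp [State.append], hm, ⟨P, hP, hn⟩, hc⟩
    · exact Or.inl (by simp [State.append, hw])
  | _ => exact Or.inl rfl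

theorem Step.aborted_cases {cfg : Config E S V} {σ σ' : State E S V A} (h : Step cfg σ σ')
    (v : V) : σ'.aborted v = σ.aborted v ∨
      ∃ m, σ'.aborted v = insert m (σ.aborted v) ∧ σ.AbortCert cfg m := by
  cases h with
  | abort w m P hf hm hP hn hc =>
    by_cases hw : v = w
    · subst hw
      exact Or.inr ⟨m, by simp [State.recordAbort], hc⟩
    · exact Or.inl (by simp [State.recordAbort, hw])
  | _ => exact Or.inl rfl

theorem Step.executed_cases {cfg : Config E S V} {σ σ' : State E S V A} (h : Step cfg σ σ')
    (v : V) : σ'.executed v = σ.executed v ∨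
      ∃ m P ids, σ'.executed v = σ.executed v ++ [m] ∧ P ∈ m.involved ∧ v ∈ cfg.execution P ∧
        (m, ids) ∈ σ.committed v ∧ m ∉ σ.executed v ∧
        ∀ k, 0 < k → k < (ids P.2).num → ∃ m' ids', (m', ids') ∈ σ.committed v ∧
          m' ∈ σ.executed v ∧ m'.coll = m.coll ∧ (ids' P.2).num = k := by
  cases h with
  | execute w m P ids hf hP hv hc he hk =>
    by_cases hw : v = w
    · subst hw
      exact Or.inr ⟨m, P, ids, by simp [State.execute], hP, hv, hc, he, hk⟩
    · exact Or.inl (by simp [State.execute, hw])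
  | _ => exact Or.inl rfl

/-! ### Monotonicity and provenance along an execution. -/

namespace IsExecution

variable {cfg : Config E S V} {σ : ℕ → State E S V A}

theorem net_mono (hσ : IsExecution cfg σ) {t t' : ℕ} (htt : t ≤ t') :
    (σ t).net ⊆ (σ t').net := by
  induction htt with
  | refl => exact subset_rfl
  | step _ ih =>
    refine ih.trans ?_
    rcases hσ.2 _ with h | h
    · rw [h]
    · rcases h.net_cases with h | ⟨x, h, -⟩
      · rw [h]
      · rw [h]
        exact Set.subset_insert _ _

theorem committed_mono (hσ : IsExecution cfg σ) (v : V) {t t' : ℕ} (htt : t ≤ t') :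
    (σ t).committed v ⊆ (σ t').committed v := by
  induction htt with
  | refl => exact List.Subset.refl _
  | step _ ih =>
    refine List.Subset.trans ih ?_
    rcases hσ.2 _ with h | h
    · rw [h]
      exact List.Subset.refl _
    · rcases h.committed_cases v with h | ⟨m, ids, h, -⟩
      · rw [h]
        exact List.Subset.refl _
      · rw [h]
        exact List.subset_append_left _ _

/-- Signatures cannot be forged: Byzantine steps only add messages of faulty signers. Freshness of
`x` at `t₀` is kept so that two messages sent at the same time can be identified. -/
theorem net_origin (hσ : IsExecution cfg σ) {x : Msg E S V A} (hx : x.signer ∉ cfg.faulty)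
    {t : ℕ} (h : x ∈ (σ t).net) : ∃ t₀ < t, x ∉ (σ t₀).net ∧
      (σ (t₀ + 1)).net = insert x (σ t₀).net ∧ Justified cfg (σ t₀) x := by
  induction t with
  | zero =>
    rw [hσ.1] at h
    exact absurd h (Set.notMem_empty x)
  | succ t ih =>
    by_cases hxt : x ∈ (σ t).net
    · obtain ⟨t₀, ht₀, h₀⟩ := ih hxt
      exact ⟨t₀, ht₀.trans (Nat.lt_succ_self t), h₀⟩
    · rcases hσ.2 t with hs | hs
      · exact absurd (hs ▸ h) hxt
      · rcases hs.net_cases with hn | ⟨y, hn, hj⟩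
        · exact absurd (hn ▸ h) hxt
        · rcases Set.mem_insert_iff.mp (hn ▸ h) with rfl | hy
          · exact ⟨t, Nat.lt_succ_self t, hxt, hn, hj hx⟩
          · exact absurd hy hxt

theorem committed_origin (hσ : IsExecution cfg σ) {v : V} {m : Request E S A}
    {ids : S → TxId E} {t : ℕ} (h : (m, ids) ∈ (σ t).committed v) :
    cfg.ValidRequest m ∧ (∃ P ∈ m.involved, cfg.IsNode P v) ∧
      ∃ t₀ < t, (σ t₀).CommitCert cfg m ids := by
  induction t with
  | zero =>
    rw [hσ.1] at h
    simp [State.init] at h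
  | succ t ih =>
    have old : (m, ids) ∈ (σ t).committed v → _ := fun h' =>
      let ⟨hm, hP, t₀, ht₀, hc⟩ := ih h'
      (⟨hm, hP, t₀, ht₀.trans (Nat.lt_succ_self t), hc⟩ :
        cfg.ValidRequest m ∧ (∃ P ∈ m.involved, cfg.IsNode P v) ∧
          ∃ t₀ < t + 1, (σ t₀).CommitCert cfg m ids)
    rcases hσ.2 t with hs | hs
    · exact old (hs ▸ h)
    · rcases hs.committed_cases v with hn | ⟨n, i, hn, hm, hP, hc⟩
      · exact old (hn ▸ h)
      · rw [hn, List.mem_append, List.mem_singleton] at h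
        rcases h with h | h
        · exact old h
        · obtain ⟨rfl, rfl⟩ := Prod.mk.inj h
          exact ⟨hm, hP, t, Nat.lt_succ_self t, hc⟩

theorem aborted_origin (hσ : IsExecution cfg σ) {v : V} {m : Request E S A} {t : ℕ}
    (h : m ∈ (σ t).aborted v) : ∃ t₀, (σ t₀).AbortCert cfg m := by
  induction t with
  | zero =>
    rw [hσ.1] at h
    exact absurd h (Set.notMem_empty m)
  | succ t ih =>
    rcases hσ.2 t with hs | hs
    · exact ih (hs ▸ h)
    · rcases hs.aborted_cases v with hn | ⟨n, hn, hc⟩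
      · exact ih (hn ▸ h)
      · rcases Set.mem_insert_iff.mp (hn ▸ h) with rfl | h
        · exact ⟨t, hc⟩
        · exact ih h

/-- A request is committed only after all involved clusters have prepared it. -/
theorem allPrepared_of_commitCert (hσ : IsExecution cfg σ) {m : Request E S A}
    (hm : cfg.ValidRequest m) {ids : S → TxId E} {t : ℕ} (h : (σ t).CommitCert cfg m ids) :
    ∃ t₀ < t, (σ t₀).AllPrepared cfg m ids := by
  obtain ⟨v, -, hvf, hv, -⟩ :=
    Signed.exists_nonfaulty (Config.involved_mem_clusters hm hm.2) h h
  obtain ⟨t₀, ht₀, -, -, hj⟩ := hσ.net_origin (x := .commit v m ids) hvf hv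
  exact ⟨t₀, ht₀, hj.1⟩

/-- The coordinator cluster does not sign both a commit and an abort message. -/
theorem not_abortCert_of_commitCert (hσ : IsExecution cfg σ) {m : Request E S A}
    (hm : cfg.ValidRequest m) {ids : S → TxId E} {t : ℕ} (h : (σ t).CommitCert cfg m ids)
    (t' : ℕ) : ¬ (σ t').AbortCert cfg m := by
  intro h'
  obtain ⟨v, -, hvf, hv, hv'⟩ :=
    Signed.exists_nonfaulty (Config.involved_mem_clusters hm hm.2) h h'
  obtain ⟨a, -, -, hna, hja⟩ := hσ.net_origin (x := .commit v m ids) hvf hv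
  obtain ⟨b, -, -, hnb, hjb⟩ := hσ.net_origin (x := .abort v m) hvf hv'
  rcases lt_trichotomy a b with hab | rfl | hab
  · exact hjb ids (hσ.net_mono hab (hna ▸ Set.mem_insert _ _))
  -- Only one message is added per step, so the commit vote would already have been sent before the
  -- abort vote.
  · have : Msg.commit v m ids ∈ insert (Msg.abort v m) (σ a).net :=
      hnb ▸ hna ▸ Set.mem_insert _ _
    rcases Set.mem_insert_iff.mp this with h | h
    · cases h
    · exact hjb ids h
  · exact hja.2 (hσ.net_mono hab (hnb ▸ Set.mem_insert _ _))

end IsExecution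

/-! ### Processing events of one node. -/

/-- At time `t`, node `v`, which maintains shard `s`, processes `m` with identifier `id`. -/
structure ProcessesAt (σ : ℕ → State E S V A) (v : V) (s : S) (m : Request E S A) (id : TxId E)
    (t : ℕ) : Prop where
  admissible : (σ t).Admissible v m
  validId : (σ t).ValidId v s m id
  net : ∃ x, x ∉ (σ t).net ∧ (σ (t + 1)).net = insert x (σ t).net ∧
    (x = .prepare v m id ∨ ∃ idc, x = .prepared v m idc id)

namespace ProcessesAt

variable {cfg : Config E S V} {σ : ℕ → State E S V A} {v : V} {s : S}
  {m m' : Request E S A} {id id' : TxId E} {t t' : ℕ}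

theorem processed (h : ProcessesAt σ v s m id t) (hσ : IsExecution cfg σ) (ht : t < t') :
    (σ t').Processed v m id := by
  obtain ⟨x, -, hx, hx'⟩ := h.net
  have hmem : x ∈ (σ t').net := hσ.net_mono ht (hx ▸ Set.mem_insert _ _)
  rcases hx' with rfl | ⟨idc, rfl⟩
  exacts [Or.inl hmem, Or.inr ⟨idc, hmem⟩]

theorem eq_of_same_time (h : ProcessesAt σ v s m id t) (h' : ProcessesAt σ v s m' id' t) :
    m = m' ∧ id = id' := by
  obtain ⟨x, hn, hx, hx'⟩ := h.net
  obtain ⟨y, hny, hy, hy'⟩ := h'.net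
  have hxy : x ∈ insert y (σ t).net := hy ▸ hx ▸ Set.mem_insert _ _
  rcases Set.mem_insert_iff.mp hxy with rfl | h
  · rcases hx' with rfl | ⟨idc, rfl⟩ <;> rcases hy' with h | ⟨idc', h⟩ <;> cases h <;>
      exact ⟨rfl, rfl⟩
  · exact absurd h hn

theorem id_unique (h : ProcessesAt σ v s m id t) (h' : ProcessesAt σ v s m id' t')
    (hσ : IsExecution cfg σ) : id = id' := by
  rcases lt_trichotomy t t' with htt | rfl | htt
  · exact absurd (h.processed hσ htt) (h'.admissible.1 _)
  · exact (h.eq_of_same_time h').2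
  · exact absurd (h'.processed hσ htt) (h.admissible.1 _)

/-- Whichever request is processed later has its number checked against the earlier one. -/
theorem num_ne (h : ProcessesAt σ v s m id t) (h' : ProcessesAt σ v s m' id' t')
    (hσ : IsExecution cfg σ) (hne : m ≠ m') (hcoll : m.coll = m'.coll) : id.num ≠ id'.num := by
  rcases lt_trichotomy t t' with htt | rfl | htt
  · exact h'.validId.2.1 m id (h.processed hσ htt) hcoll hne
  · exact absurd (h.eq_of_same_time h').1 hne
  · exact (h.validId.2.1 m' id' (h'.processed hσ htt) hcoll.symm hne.symm).symm

end ProcessesAt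

/-! ### Uniqueness of identifiers and sequence numbers. -/

namespace IsExecution

variable {cfg : Config E S V} {σ : ℕ → State E S V A} {m m' : Request E S A}
  {ids ids' : S → TxId E} {P : E × S} {t t' : ℕ}

theorem processed_origin (hσ : IsExecution cfg σ) (hP : P ∈ cfg.clusters) {v : V}
    (hv : v ∈ cfg.ordering P) (hvf : v ∉ cfg.faulty) {id : TxId E}
    (h : (σ t).Processed v m id) : ∃ t₀ < t, ProcessesAt σ v P.2 m id t₀ := by
  -- Messages do not name the signer's cluster; it is recovered because a node belongs to only one.
  have huniq : ∀ Q ∈ m.involved, cfg.ValidRequest m → v ∈ cfg.ordering Q → Q = P :=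
    fun Q hQ hm hvQ => cfg.cluster_unique Q (Config.involved_mem_clusters hm hQ) P hP v
      (Or.inl hvQ) (Or.inl hv)
  rcases h with h | ⟨idc, h⟩
  · obtain ⟨t₀, ht₀, hn, hnet, hm, Q, hQ, hvQ, ha, hi⟩ :=
      hσ.net_origin (x := .prepare v m id) hvf h
    obtain rfl := huniq Q hQ hm hvQ
    exact ⟨t₀, ht₀, ha, hi, _, hn, hnet, Or.inl rfl⟩
  · obtain ⟨t₀, ht₀, hn, hnet, hm, Q, hQ, hvQ, ha, hi⟩ :=
      hσ.net_origin (x := .prepared v m idc id) hvf h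
    obtain rfl := huniq Q hQ hm hvQ
    exact ⟨t₀, ht₀, ha, hi, _, hn, hnet, Or.inr ⟨idc, rfl⟩⟩

/-- In each cluster involved in two prepared requests, some non-faulty node has processed both. -/
theorem exists_processesAt (hσ : IsExecution cfg σ) (hm : cfg.ValidRequest m)
    (h : (σ t).AllPrepared cfg m ids) (h' : (σ t').AllPrepared cfg m' ids')
    (hP : P ∈ m.involved) (hP' : P ∈ m'.involved) :
    ∃ v, ∃ a < t, ∃ b < t', ProcessesAt σ v P.2 m (ids P.2) a ∧
      ProcessesAt σ v P.2 m' (ids' P.2) b := by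
  obtain ⟨v, hv, hvf, h1, h2⟩ := AllPrepared.exists_processed hm hP hP' h h'
  have hc := Config.involved_mem_clusters hm hP
  obtain ⟨a, ha, hpa⟩ := hσ.processed_origin hc hv hvf h1
  obtain ⟨b, hb, hpb⟩ := hσ.processed_origin hc hv hvf h2
  exact ⟨v, a, ha, b, hb, hpa, hpb⟩

/-- A non-faulty node of `P` voted for both identifiers but processed `m` only once. Nothing is
claimed on shards that `m` does not access, so agreement is pointwise. -/
theorem ids_unique (hσ : IsExecution cfg σ) (hm : cfg.ValidRequest m)
    (h : (σ t).AllPrepared cfg m ids) (h' : (σ t').AllPrepared cfg m ids')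
    (hP : P ∈ m.involved) : ids P.2 = ids' P.2 := by
  obtain ⟨v, a, -, b, -, hpa, hpb⟩ := hσ.exists_processesAt hm h h' hP hP
  exact hpa.id_unique hpb hσ

/-- Needed because the execution rule speaks only of numbers `0 < k`; the bound comes from the
strict inequality in `ValidId`. -/
theorem num_pos (hσ : IsExecution cfg σ) (hm : cfg.ValidRequest m)
    (h : (σ t).AllPrepared cfg m ids) (hP : P ∈ m.involved) : 0 < (ids P.2).num := by
  obtain ⟨v, a, -, b, -, hpa, -⟩ := hσ.exists_processesAt hm h h hP hP
  exact (Nat.zero_le _).trans_lt hpa.validId.1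

theorem eq_of_num_eq (hσ : IsExecution cfg σ) (hm : cfg.ValidRequest m)
    (h : (σ t).AllPrepared cfg m ids) (h' : (σ t').AllPrepared cfg m' ids')
    (hP : P ∈ m.involved) (hP' : P ∈ m'.involved) (hcoll : m.coll = m'.coll)
    (hnum : (ids P.2).num = (ids' P.2).num) : m = m' := by
  obtain ⟨v, a, -, b, -, hpa, hpb⟩ := hσ.exists_processesAt hm h h' hP hP'
  by_contra hne
  exact hpa.num_ne hpb hσ hne hcoll hnum

theorem committed_allPrepared (hσ : IsExecution cfg σ) {v : V}
    (h : (m, ids) ∈ (σ t).committed v) : ∃ t₀ < t, (σ t₀).AllPrepared cfg m ids := by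
  obtain ⟨hm, -, t₁, ht₁, hc⟩ := hσ.committed_origin h
  obtain ⟨t₀, ht₀, hp⟩ := hσ.allPrepared_of_commitCert hm hc
  exact ⟨t₀, ht₀.trans ht₁, hp⟩

/-! ### Consistency of the commitment order. -/

/-- A node that has committed `m'` before processing `m` orders `m` after `m'`. -/
theorem orderedAfter_of_committed (hσ : IsExecution cfg σ) {v : V} {id id' : TxId E} {s : S}
    (h : ProcessesAt σ v s m id t) (h' : ProcessesAt σ v s m' id' t') (htt : t' ≤ t)
    (hs : s ∈ m'.shards) (hc : (m', ids') ∈ (σ t).committed v) (hid : ids' s = id')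
    (hcmp : m.coll = m'.coll ∨ m.coll ⊂ m'.coll ∨ m'.coll ⊂ m.coll) :
    OrderedAfter m id m' id' := by
  have hle := State.le_lastCommitted hc hs
  rw [hid] at hle
  rcases hcmp with hcmp | hcmp | hcmp
  · refine Or.inl ⟨hcmp, hle.trans_lt ?_⟩
    rw [← hcmp]
    exact h.validId.1
  · refine Or.inr (Or.inl ⟨hcmp, ?_⟩)
    rw [h.validId.2.2, if_pos hcmp]
    exact hle
  · refine Or.inr (Or.inr ⟨hcmp, ?_⟩)
    rw [h'.validId.2.2, if_pos hcmp]
    -- Here `m'` captured the state of the larger collection when it was processed. That state has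
    -- only grown by the time `m` receives a still larger number.
    exact (State.lastCommitted_mono (hσ.committed_mono v htt) _ _).trans_lt h.validId.1

/-- If `m'` was prepared by all involved clusters no later than `m` was for the first time, and the
requests intersect in two shards, then `m` is ordered after `m'` in every common cluster. -/
theorem orderedAfter_of_prepared_le (hσ : IsExecution cfg σ) (hm : cfg.ValidRequest m)
    (hm' : cfg.ValidRequest m') (hne : m ≠ m') (h : (σ t).AllPrepared cfg m ids)
    (h' : (σ t').AllPrepared cfg m' ids') (htt : t' ≤ t)
    (hmin : ∀ a < t, ∀ i, ¬ (σ a).AllPrepared cfg m i)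
    (hab : ∀ a, ¬ (σ a).AbortCert cfg m) (hab' : ∀ a, ¬ (σ a).AbortCert cfg m')
    (hshare : 2 ≤ (sharedShards m m').card) (hP : P ∈ m.involved) (hP' : P ∈ m'.involved)
    (hcmp : m.coll = m'.coll ∨ m.coll ⊂ m'.coll ∨ m'.coll ⊂ m.coll) :
    OrderedAfter m (ids P.2) m' (ids' P.2) := by
  obtain ⟨v, a, -, b, hb, hpa, hpb⟩ := hσ.exists_processesAt hm h h' hP hP'
  rcases lt_trichotomy a b with hlt | rfl | hlt
  · have hshare' : 2 ≤ (sharedShards m' m).card := by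
      rwa [sharedShards, Finset.inter_comm]
    rcases hpb.admissible.2 m _ (hpa.processed hσ hlt) hshare' with ⟨i, hi⟩ | hi
    · obtain ⟨t₀, ht₀, hp⟩ := hσ.committed_allPrepared hi
      -- `m` would be fully prepared before `b < t' ≤ t`, earlier than its first time.
      exact absurd hp (hmin t₀ (by omega) i)
    · obtain ⟨t₀, hc⟩ := hσ.aborted_origin hi
      exact absurd hc (hab t₀)
  · exact absurd (hpa.eq_of_same_time hpb).1 hne
  · rcases hpa.admissible.2 m' _ (hpb.processed hσ hlt) hshare with ⟨i, hi⟩ | hi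
    · obtain ⟨t₀, -, hp⟩ := hσ.committed_allPrepared hi
      exact hσ.orderedAfter_of_committed hpa hpb hlt.le (Finset.mem_product.mp hP').2 hi
        (hσ.ids_unique hm' hp h' hP') hcmp
    · obtain ⟨t₀, hc⟩ := hσ.aborted_origin hi
      exact absurd hc (hab' t₀)

/-- The identifiers of two committed requests impose the same order in all common clusters. -/
theorem orderedAfter_transfer (hσ : IsExecution cfg σ) {r r' : V}
    (hc : (m, ids) ∈ (σ t).committed r) (hc' : (m', ids') ∈ (σ t').committed r')
    {P₁ P₂ : E × S} (hP₁ : P₁ ∈ m.involved ∩ m'.involved) (hP₂ : P₂ ∈ m.involved ∩ m'.involved)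
    (h : OrderedAfter m (ids P₁.2) m' (ids' P₁.2)) :
    OrderedAfter m (ids P₂.2) m' (ids' P₂.2) := by
  by_cases hs : P₁.2 = P₂.2
  · rwa [← hs]
  have hshare : 2 ≤ (sharedShards m m').card :=
    Finset.one_lt_card.mpr ⟨P₁.2, Finset.mem_image_of_mem _ hP₁, P₂.2,
      Finset.mem_image_of_mem _ hP₂, hs⟩
  have hshare' : 2 ≤ (sharedShards m' m).card := by
    rwa [sharedShards, Finset.inter_comm]
  rw [Finset.mem_inter] at hP₁ hP₂
  obtain ⟨hm, -, a, -, hca⟩ := hσ.committed_origin hc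
  obtain ⟨hm', -, a', -, hca'⟩ := hσ.committed_origin hc'
  have hab := hσ.not_abortCert_of_commitCert hm hca
  have hab' := hσ.not_abortCert_of_commitCert hm' hca'
  obtain ⟨b, -, hpb⟩ := hσ.committed_allPrepared hc
  obtain ⟨b', -, hpb'⟩ := hσ.committed_allPrepared hc'
  have hne : m ≠ m' := by
    rintro rfl
    rw [hσ.ids_unique hm hpb hpb' hP₁.1] at h
    exact h.asymm h
  classical
  -- The first preparation times may come with other identifier functions than the committed blocks;
  -- `ids_unique` matches them on the two shards concerned.
  have hex : ∃ u i, (σ u).AllPrepared cfg m i := ⟨b, ids, hpb⟩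
  have hex' : ∃ u i, (σ u).AllPrepared cfg m' i := ⟨b', ids', hpb'⟩
  obtain ⟨i, hi⟩ := Nat.find_spec hex
  obtain ⟨i', hi'⟩ := Nat.find_spec hex'
  have hmin : ∀ u < Nat.find hex, ∀ j, ¬ (σ u).AllPrepared cfg m j :=
    fun u hu j hj => Nat.find_min hex hu ⟨j, hj⟩
  have hmin' : ∀ u < Nat.find hex', ∀ j, ¬ (σ u).AllPrepared cfg m' j :=
    fun u hu j hj => Nat.find_min hex' hu ⟨j, hj⟩
  rw [hσ.ids_unique hm hpb hi hP₁.1, hσ.ids_unique hm' hpb' hi' hP₁.2] at h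
  rw [hσ.ids_unique hm hpb hi hP₂.1, hσ.ids_unique hm' hpb' hi' hP₂.2]
  rcases le_total (Nat.find hex') (Nat.find hex) with hle | hle
  · exact hσ.orderedAfter_of_prepared_le hm hm' hne hi hi' hle hmin hab hab' hshare
      hP₂.1 hP₂.2 h.comparable
  -- If `m` was prepared first, the reverse order would hold in `P₁` as well, against the hypothesis
  -- there.
  · refine absurd (hσ.orderedAfter_of_prepared_le hm' hm hne.symm hi' hi hle hmin' hab' hab
      hshare' hP₁.2 hP₁.1 ?_) h.asymm
    rcases h.comparable with hc | hc | hc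
    exacts [Or.inl hc.symm, Or.inr (Or.inr hc), Or.inr (Or.inl hc)]

theorem committedAfter_transfer (hσ : IsExecution cfg σ) {P₁ P₂ : E × S}
    (hP₁ : P₁ ∈ m.involved ∩ m'.involved) (hP₂ : P₂ ∈ m.involved ∩ m'.involved) {r₁ r₂ : V}
    (hc : (σ t').CommittedOn r₂ m) (hc' : (σ t').CommittedOn r₂ m')
    (h : (σ t).CommittedAfter r₁ P₁.2 m m') : (σ t').CommittedAfter r₂ P₂.2 m m' := by
  obtain ⟨i, i', hi, hi', ho⟩ := h
  obtain ⟨j, hj⟩ := hc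
  obtain ⟨j', hj'⟩ := hc'
  refine ⟨j, j', hj, hj', hσ.orderedAfter_transfer hj hj' hP₁ hP₂ ?_⟩
  rw [Finset.mem_inter] at hP₁
  obtain ⟨_, -, hpi⟩ := hσ.committed_allPrepared hi
  obtain ⟨_, -, hpi'⟩ := hσ.committed_allPrepared hi'
  obtain ⟨_, -, hpj⟩ := hσ.committed_allPrepared hj
  obtain ⟨_, -, hpj'⟩ := hσ.committed_allPrepared hj'
  -- The blocks held by `r₂` also carry the identifiers on the shard of `P₁`, where they agree with
  -- those of `r₁`.
  rwa [hσ.ids_unique (hσ.committed_origin hj).1 hpj hpi hP₁.1,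
    hσ.ids_unique (hσ.committed_origin hj').1 hpj' hpi' hP₁.2]

/-! ### Consistency of the execution order. -/

/-- A request executed by a node of `P` is committed there, and every committed request of the same
collection with a smaller sequence number has been executed before it. -/
theorem executed_spec (hσ : IsExecution cfg σ) {v : V} (hv : cfg.IsNode P v)
    (hP : P ∈ m.involved) (h : m ∈ (σ t).executed v) :
    ∃ ids, (m, ids) ∈ (σ t).committed v ∧
      ∀ m' ids' u w, P ∈ m'.involved → (m', ids') ∈ (σ u).committed w →
        m'.coll = m.coll → (ids' P.2).num < (ids P.2).num → (σ t).ExecutedAfter v m m' := by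
  induction t with
  | zero =>
    rw [hσ.1] at h
    simp [State.init] at h
  | succ t ih =>
    rcases hσ.2 t with hs | hs
    · rw [hs] at h ⊢
      exact ih h
    · have hmono := hσ.committed_mono v (Nat.le_succ t)
      rcases hs.executed_cases v with hn | ⟨n, Q, ids, hn, hQ, hvQ, hc, he, hk⟩
      · obtain ⟨ids, hc, hlow⟩ := ih (hn ▸ h)
        refine ⟨ids, hmono hc, fun m' ids' u w h1 h2 h3 h4 => ?_⟩
        rw [State.ExecutedAfter, hn]
        exact hlow m' ids' u w h1 h2 h3 h4
      · rw [hn, List.mem_append, List.mem_singleton] at h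
        rcases h with h | rfl
        · obtain ⟨ids, hc, hlow⟩ := ih h
          refine ⟨ids, hmono hc, fun m' ids' u w h1 h2 h3 h4 => ?_⟩
          rw [State.ExecutedAfter, hn]
          exact (hlow m' ids' u w h1 h2 h3 h4).trans (List.sublist_append_left _ _)
        · have hm := (hσ.committed_origin hc).1
          obtain rfl := Config.eq_of_isNode hm hm hP hQ hv (Or.inr hvQ)
          refine ⟨ids, hmono hc, fun m' ids' u w hP' hc' hcoll hlt => ?_⟩
          have hm' := (hσ.committed_origin hc').1
          obtain ⟨_, -, hp'⟩ := hσ.committed_allPrepared hc'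
          -- The absence of gaps yields some executed request `n` with the number of `m'`;
          -- uniqueness of numbers then shows that `n` is `m'`, even if `m'` was only known to be
          -- committed on another node.
          obtain ⟨n, i, hci, hni, hncoll, hnum⟩ := hk _ (hσ.num_pos hm' hp' hP') hlt
          obtain ⟨hvn, ⟨R, hR, hvR⟩, -⟩ := hσ.committed_origin hci
          obtain rfl := Config.eq_of_isNode hm hvn hP hR hv hvR
          obtain ⟨_, -, hpn⟩ := hσ.committed_allPrepared hci
          obtain rfl := hσ.eq_of_num_eq hvn hpn hp' hR hP' (hncoll.trans hcoll.symm) hnum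
          rw [State.ExecutedAfter, hn]
          exact (List.singleton_sublist.mpr hni).append (List.Sublist.refl [m])

theorem executed_nodup (hσ : IsExecution cfg σ) (v : V) (t : ℕ) :
    ((σ t).executed v).Nodup := by
  induction t with
  | zero =>
    rw [hσ.1]
    exact List.nodup_nil
  | succ t ih =>
    rcases hσ.2 t with hs | hs
    · rwa [hs]
    · rcases hs.executed_cases v with hn | ⟨n, -, -, hn, -, -, -, he, -⟩
      · rwa [hn]
      · rw [hn, ← List.concat_eq_append]
        exact ih.concat he

/-- `r₂` is not assumed to have committed `m'`. The block of `m'` on `r₁` suffices, since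
`executed_spec` accepts blocks committed on any node at any time. -/
theorem executedAfter_transfer (hσ : IsExecution cfg σ) {P₁ P₂ : E × S}
    (hP₁ : P₁ ∈ m.involved ∩ m'.involved) (hP₂ : P₂ ∈ m.involved ∩ m'.involved) {r₁ r₂ : V}
    (hr₁ : cfg.IsNode P₁ r₁) (hr₂ : cfg.IsNode P₂ r₂) (hcoll : m.coll = m'.coll)
    (he : m ∈ (σ t').executed r₂) (h : (σ t).ExecutedAfter r₁ m m') :
    (σ t').ExecutedAfter r₂ m m' := by
  have hP₁' := Finset.mem_inter.mp hP₁
  have hP₂' := Finset.mem_inter.mp hP₂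
  have hnodup := hσ.executed_nodup r₁ t
  obtain ⟨i, hi, -⟩ := hσ.executed_spec hr₁ hP₁'.1 (h.subset (by simp))
  obtain ⟨i', hi', hlow⟩ := hσ.executed_spec hr₁ hP₁'.2 (h.subset (by simp))
  obtain ⟨j, hj, hlow₂⟩ := hσ.executed_spec hr₂ hP₂'.1 he
  have hm := (hσ.committed_origin hi).1
  obtain ⟨_, -, hpi⟩ := hσ.committed_allPrepared hi
  obtain ⟨_, -, hpi'⟩ := hσ.committed_allPrepared hi'
  obtain ⟨_, -, hpj⟩ := hσ.committed_allPrepared hj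
  -- Equal numbers would make the requests equal and repeat an entry of a duplicate-free list. A
  -- smaller number for `m` would force the opposite order of execution.
  have hlt : (i' P₁.2).num < (i P₁.2).num := by
    rcases lt_trichotomy (i' P₁.2).num (i P₁.2).num with hlt | heq | hlt
    · exact hlt
    · obtain rfl := hσ.eq_of_num_eq hm hpi hpi' hP₁'.1 hP₁'.2 hcoll heq.symm
      have := hnodup.sublist h
      simp at this
    · exact (not_sublist_swap hnodup h (hlow m i t r₁ hP₁'.1 hi hcoll hlt)).elim
  refine hlow₂ m' i' t r₁ hP₂'.2 hi' hcoll.symm ?_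
  rw [hσ.ids_unique hm hpj hpi hP₂'.1]
  rcases hσ.orderedAfter_transfer hi hi' hP₁ hP₂ (Or.inl ⟨hcoll, hlt⟩) with ho | ho | ho
  · exact ho.2
  · exact absurd hcoll ho.1.ne
  · exact absurd hcoll ho.1.ne'

end IsExecution

end Qanaat

theorem mainTheorem2 {E S V A : Type*} [DecidableEq E] [DecidableEq S]
    (cfg : Qanaat.Config E S V) (σ : ℕ → Qanaat.State E S V A) (hσ : Qanaat.IsExecution cfg σ)
    (m m' : Qanaat.Request E S A) (P₁ P₂ : E × S)
    (hP₁ : P₁ ∈ m.involved ∩ m'.involved) (hP₂ : P₂ ∈ m.involved ∩ m'.involved)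
    (r₁ r₂ : V) (hr₁ : cfg.IsNode P₁ r₁) (hr₂ : cfg.IsNode P₂ r₂)
    (hf₁ : r₁ ∉ cfg.faulty) (hf₂ : r₂ ∉ cfg.faulty) (t₁ t₂ : ℕ) :
    ((σ t₂).CommittedOn r₂ m → (σ t₂).CommittedOn r₂ m' →
      (σ t₁).CommittedAfter r₁ P₁.2 m m' → (σ t₂).CommittedAfter r₂ P₂.2 m m') ∧
    (m.coll = m'.coll → m ∈ (σ t₂).executed r₂ →
      (σ t₁).ExecutedAfter r₁ m m' → (σ t₂).ExecutedAfter r₂ m m') := by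
  exact ⟨fun hc hc' h => hσ.committedAfter_transfer hP₁ hP₂ hc hc' h,
    fun hcoll he h => hσ.executedAfter_transfer hP₁ hP₂ hr₁ hr₂ hcoll he h⟩
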